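/- Let $M,d,p\ge 0$ be integers and let $f:(\mathbb R^d)^M\to\mathbb R^p$ be continuous and permutation-invariant, i.e. $f(x_{\pi(1)},\dots,x_{\pi(M)})=f(x_1,\dots,x_M)$ for all $\pi\in S_M$. Let $K\subset(\mathbb R^d)^M$ be compact and $\varepsilon>0$. Fix a number of heads $H\ge 1$, a key dimension $k$ per head, an activation $\sigma(t)=\mathrm{LeakyReLU}_a(t)=t$ for $t\ge0$ and $at$ for $t<0$, with slope $0\le a<1$, and a constant $\eta>0$. An MLP $\mathbb R^m\to\mathbb R^n$ means a map $v\mapsto W_2\,\sigma(W_1v+b_1)+b_2$ of some finite hidden width, with $\sigma$ applied coordinatewise. $\|\cdot\|$ is the Euclidean norm. (1) (Multi-head residual graph-attention CLARGA network.) For every depth $D\ge 0$ (in particular $D=3$) there are a latent width $w$ and weights $\theta=(\phi,W_q,W_k,W_g,q_F,g)$, where $\phi:\mathbb R^d\to\mathbb R^w$ and $g:\mathbb R^w\to\mathbb R^p$ are MLPs, $W_q^{(t)},W_k^{(t)}\in\mathbb R^{k\times w}$ and $q_F^{(t)}\in\mathbb R^k$ for $1\le t\le H$, and $W_g\in\mathbb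 R^{w\times 2w}$, such that $$\sup_{x\in K}\|\mathrm{CLARGA}_\theta(x)-f(x)\|<\varepsilon .$$ Here $\mathrm{CLARGA}_\theta(x)$ is computed as follows. Put $h_i^{(0)}=\phi(x_i)$, $e^{(t)}_{ij}=\sigma\bigl((W_q^{(t)}h_i^{(0)})^{\top}W_k^{(t)}h_j^{(0)}\bigr)$, $\alpha^{(t)}_{ii}=0$ and $\alpha^{(t)}_{ij}=\exp(e^{(t)}_{ij})/\sum_{l\ne i}\exp(e^{(t)}_{il})$ for $j\neq i$. For $0\le\ell<D$ put $m^{(\ell)}_i=\frac1H\sum_t\sum_j\alpha^{(t)}_{ij}h^{(\ell)}_j$ and $h_i^{(\ell+1)}=\mathrm{LN}\bigl(h_i^{(\ell)}+W_g[h_i^{(\ell)}\,\Vert\,m_i^{(\ell)}]\bigr)$, where $\mathrm{LN}(u)_c=(u_c-\mu(u))/\sqrt{\mathrm{Var}(u)+\eta}$, with $\mu(u)$ and $\mathrm{Var}(u)$ the mean and variance of the coordinates of $u$. Finally, $(\beta_i)_i$ is the softmax over the nodes $i$ of the scores $\sum_t q_F^{(t)\top}W_k^{(t)}h_i^{(D)}$,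 and $\mathrm{CLARGA}_\theta(x)=g\bigl(\sum_i\beta_ih_i^{(D)}\bigr)$. (2) (Three-layer multi-head CLARGA fusion block: attention sum, nonlinear projection, read-out.) There are an integer $r$ and weights $\theta=(W_q,W_k,\phi,\rho)$, where $W_q^{(t)},W_k^{(t)}\in\mathbb R^{k\times d}$ for $1\le t\le H$, and $\phi:\mathbb R^d\to\mathbb R^r$ and $\rho:\mathbb R^r\to\mathbb R^p$ are MLPs, such that $$\sup_{x\in K}\|\mathrm{Block}_\theta(x)-f(x)\|<\varepsilon,$$ where $$\mathrm{Block}_\theta(x)=\rho\Bigl(\sigma\Bigl(\tfrac1H\sum_{t=1}^H\sum_{i=1}^M\alpha_i^{(t)}\phi(x_i)\Bigr)\Bigr),\qquad \alpha^{(t)}_i=\frac{\exp\langle W_q^{(t)}x_i,W_k^{(t)}x_i\rangle}{\sum_j\exp\langle W_q^{(t)}x_j,W_k^{(t)}x_j\rangle}.$$ -/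

import Mathlib

open scoped Matrix

noncomputable section

namespace Clarga

/-- Leaky rectified linear unit with negative slope `a` (`a = 0` is the ordinary ReLU). -/
def leakyReLU (a t : ℝ) : ℝ := if 0 ≤ t then t else a * t

/-- Weights of a two-layer perceptron (one hidden layer of finite width, with biases) `ℝᵐ → ℝⁿ`. -/
structure MLP (m n : ℕ) where
  width : ℕ
  W₁ : Matrix (Fin width) (Fin m) ℝ
  b₁ : Fin width → ℝ
  W₂ : Matrix (Fin n) (Fin width) ℝ
  b₂ : Fin n → ℝ

/-- The map `v ↦ W₂ σ(W₁ v + b₁) + b₂`, with `σ` the leaky ReLU of slope `a`. -/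
def MLP.eval (a : ℝ) {m n : ℕ} (N : MLP m n) (v : Fin m → ℝ) : Fin n → ℝ :=
  N.W₂ *ᵥ (fun c => leakyReLU a ((N.W₁ *ᵥ v + N.b₁) c)) + N.b₂

/-- Softmax of finitely many scores. -/
def softmax {M : ℕ} (s : Fin M → ℝ) (i : Fin M) : ℝ :=
  Real.exp (s i) / ∑ j, Real.exp (s j)

/-- Feature-wise mean of a vector. -/
def mean {w : ℕ} (u : Fin w → ℝ) : ℝ := (1 / (w : ℝ)) * ∑ c, u c

/-- Feature-wise variance of a vector. -/
def var {w : ℕ} (u : Fin w → ℝ) : ℝ := (1 / (w : ℝ)) * ∑ c, (u c - mean u) ^ 2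

/-- Affine-free layer normalization with stabilizer `η`. -/
def layerNorm (η : ℝ) {w : ℕ} (u : Fin w → ℝ) : Fin w → ℝ :=
  fun c => (u c - mean u) / Real.sqrt (var u + η)

/-! ### Residual graph-attention fusion network -/

/-- Weights of the network: latent width `w`, `H` heads with keys and queries in `ℝ^k` per head.
The embedding perceptron is shared by all nodes, the weights `Wg` by all layers. -/
structure ResidualWeights (d p w H k : ℕ) where
  enc : MLP d w
  Wq : Fin H → Matrix (Fin k) (Fin w) ℝ
  Wk : Fin H → Matrix (Fin k) (Fin w) ℝ
  Wg : Matrix (Fin w) (Fin w ⊕ Fin w) ℝ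
  qF : Fin H → Fin k → ℝ
  head : MLP w p

namespace ResidualWeights

variable {M d p w H k : ℕ}

/-- Compatibility score of nodes `i`, `j` in head `t`. -/
def score (a : ℝ) (θ : ResidualWeights d p w H k) (h : Fin M → Fin w → ℝ)
    (t : Fin H) (i j : Fin M) : ℝ :=
  leakyReLU a ((θ.Wq t *ᵥ h i) ⬝ᵥ (θ.Wk t *ᵥ h j))

/-- Attention coefficient of node `i` for node `j` in head `t`: a softmax over the nodes other
than `i` (the diagonal scores are `-∞`). -/
def attn (a : ℝ) (θ : ResidualWeights d p w H k) (h : Fin M → Fin w → ℝ)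
    (t : Fin H) (i j : Fin M) : ℝ :=
  if j = i then 0
  else Real.exp (θ.score a h t i j) /
    ∑ l ∈ Finset.univ.erase i, Real.exp (θ.score a h t i l)

/-- Message to node `i` in the state `g`, for attention coefficients `α`, averaged over heads. -/
def message (α : Fin H → Fin M → Fin M → ℝ) (g : Fin M → Fin w → ℝ) (i : Fin M) : Fin w → ℝ :=
  (1 / (H : ℝ)) • ∑ t, ∑ j, α t i j • g j

/-- One residual graph-attention layer: `gᵢ ↦ LayerNorm (gᵢ + Wg [gᵢ ‖ mᵢ])`. -/
def layer (η : ℝ) (θ : ResidualWeights d p w H k) (α : Fin H → Fin M → Fin M → ℝ)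
    (g : Fin M → Fin w → ℝ) : Fin M → Fin w → ℝ :=
  fun i => layerNorm η (g i + θ.Wg *ᵥ Sum.elim (g i) (message α g i))

/-- Node states after `D` layers. The attention coefficients are computed from the initial
states. -/
def states (a η : ℝ) (D : ℕ) (θ : ResidualWeights d p w H k)
    (h : Fin M → Fin w → ℝ) : Fin M → Fin w → ℝ :=
  (θ.layer η (θ.attn a h))^[D] h

/-- Read-out: softmax-weighted sum of the states, with scores `q_Fᵀ W_k gᵢ`. -/
def readOut (θ : ResidualWeights d p w H k) (g : Fin M → Fin w → ℝ) : Fin w → ℝ :=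
  ∑ i, softmax (fun l => ∑ t, θ.qF t ⬝ᵥ (θ.Wk t *ᵥ g l)) i • g i

/-- The function computed by the network (dropout is inactive). -/
def eval (a η : ℝ) (D : ℕ) (θ : ResidualWeights d p w H k)
    (x : Fin M → EuclideanSpace ℝ (Fin d)) : EuclideanSpace ℝ (Fin p) :=
  WithLp.toLp 2
    (θ.head.eval a (θ.readOut (θ.states a η D (fun i => θ.enc.eval a (x i).ofLp))))

end ResidualWeights

/-! ### Three-layer fusion block: attention sum, nonlinear projection, read-out -/

/-- Weights of the three-layer block: `H` heads with keys and queries in `ℝ^k` per head, a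
perceptron as value map, and the affine maps of the second and third layers. -/
structure BlockWeights (d p r H k : ℕ) where
  Wq : Fin H → Matrix (Fin k) (Fin d) ℝ
  Wk : Fin H → Matrix (Fin k) (Fin d) ℝ
  value : MLP d r
  out : MLP r p

namespace BlockWeights

variable {M d p r H k : ℕ}

/-- First layer: `∑ᵢ αᵢ φ(xᵢ)` with `α` the softmax of `⟨W_q xᵢ, W_k xᵢ⟩`, averaged over heads. -/
def attnSum (a : ℝ) (θ : BlockWeights d p r H k) (x : Fin M → Fin d → ℝ) : Fin r → ℝ :=
  (1 / (H : ℝ)) • ∑ t, ∑ i,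
    softmax (fun l => (θ.Wq t *ᵥ x l) ⬝ᵥ (θ.Wk t *ᵥ x l)) i • θ.value.eval a (x i)

/-- The function computed by the block: the attention sum, then an activation and an affine map
(second layer), then again an activation and an affine map (third layer). -/
def eval (a : ℝ) (θ : BlockWeights d p r H k)
    (x : Fin M → EuclideanSpace ℝ (Fin d)) : EuclideanSpace ℝ (Fin p) :=
  WithLp.toLp 2
    (θ.out.eval a (fun c => leakyReLU a (θ.attnSum a (fun i => (x i).ofLp) c)))

end BlockWeights

end Clarga

end

/-! The construction switches attention off: with vanishing keys and queries every softmax is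
uniform, and both networks become mean-pooling networks `x ↦ ρ (1/M ∑ᵢ φ(xᵢ))`, up to layer
normalization in the first and one additional activation in the second.

Mean-pooling networks with continuous `φ` and `ρ` approximate every continuous symmetric function
on a compact set `K` (`exists_mean_near`). The functions of this form are an algebra on the quotient
of `K` by the relation "all sums `∑ᵢ ψ(xᵢ)` agree". They separate the points of that compact
quotient, so the Stone-Weierstrass theorem applies, and a symmetric `f` descends to the quotient
because the sums determine the points up to permutation (`exists_perm_of_sum_eq`). The continuous
`φ` and `ρ` are then replaced by perceptrons (`exists_mlp_mean_near`), which are dense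
(`exists_mlp_near`): Stone-Weierstrass for the span of the functions `v ↦ exp (w ⬝ᵥ v)` reduces this
to one variable, where piecewise linear interpolation is a sum of ReLU ramps.

The activation in the second network is undone by the features `(φ, -φ)`, as
`σ(t) - σ(-t) = (1 + a) t` (`exists_block_eq`). In the first network the layer weights are `0` too,
so `D` layers are the `D`-fold layer normalization `LN^D`. It distorts the features, but for `v` of
mean zero `LN (δ v) = δ v / √(δ² Var v + η)`, and so `δ⁻¹ LN^D (δ v)` tends to `v / √η ^ D`
as `δ → 0`, uniformly on compact sets. Encoding by `δ (φ, -φ)`, whose mean is zero, and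
rescaling in the head therefore realizes mean pooling in the limit (`exists_residual_near`). -/

noncomputable section

namespace Clarga

open Set Filter Topology

/-! ### The space of functions computed by two-layer perceptrons -/

section

/-- The functions `ℝᵐ → ℝⁿ` computed by perceptrons of arbitrary finite hidden width, as a linear
subspace of all functions: hidden layers are juxtaposed to add two perceptrons. -/
def mlpSpace (a : ℝ) (m n : ℕ) : Submodule ℝ ((Fin m → ℝ) → Fin n → ℝ) where
  carrier := range fun N : MLP m n => N.eval a
  zero_mem' := ⟨⟨0, 0, 0, 0, 0⟩, by ext v c; simp [MLP.eval]⟩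
  add_mem' := by
    rintro _ _ ⟨N, rfl⟩ ⟨N', rfl⟩
    refine ⟨⟨N.width + N'.width,
      Fin.append (α := Fin m → ℝ) N.W₁ N'.W₁, Fin.append N.b₁ N'.b₁,
      fun c => Fin.append (N.W₂ c) (N'.W₂ c), N.b₂ + N'.b₂⟩, ?_⟩
    ext v c
    have hl (j) : Fin.append (α := Fin m → ℝ) N.W₁ N'.W₁ (Fin.castAdd _ j) = N.W₁ j :=
      Fin.append_left ..
    have hr (j) : Fin.append (α := Fin m → ℝ) N.W₁ N'.W₁ (Fin.natAdd _ j) = N'.W₁ j :=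
      Fin.append_right ..
    simp only [MLP.eval, Pi.add_apply, Matrix.mulVec, dotProduct, Fin.sum_univ_add,
      Fin.append_left, Fin.append_right, hl, hr]
    ring
  smul_mem' := by
    rintro s _ ⟨N, rfl⟩
    refine ⟨⟨N.width, N.W₁, N.b₁, s • N.W₂, s • N.b₂⟩, ?_⟩
    ext v c
    simp [MLP.eval, Matrix.smul_mulVec, mul_add]

variable {a : ℝ} {m n l : ℕ}

lemma const_mem_mlpSpace (b : Fin n → ℝ) : (fun _ => b) ∈ mlpSpace a m n :=
  ⟨⟨0, 0, 0, 0, b⟩, by ext v c; simp [MLP.eval]⟩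

lemma leakyReLU_ridge_mem_mlpSpace (w : Fin m → ℝ) (b : ℝ) :
    (fun v _ => leakyReLU a (w ⬝ᵥ v + b)) ∈ mlpSpace a m 1 :=
  ⟨⟨1, fun _ => w, fun _ => b, 1, 0⟩, by
    ext v c; simp [MLP.eval, Matrix.mulVec]⟩

lemma linear_comp_mem_mlpSpace {g : (Fin m → ℝ) → Fin n → ℝ} (hg : g ∈ mlpSpace a m n)
    (A : (Fin n → ℝ) →ₗ[ℝ] (Fin l → ℝ)) : (fun v => A (g v)) ∈ mlpSpace a m l := by
  obtain ⟨N, rfl⟩ := hg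
  refine ⟨⟨N.width, N.W₁, N.b₁, A.toMatrix' * N.W₂, A N.b₂⟩, ?_⟩
  ext v c
  simp [MLP.eval, ← Matrix.mulVec_mulVec, ← Matrix.toLin'_apply A.toMatrix']

lemma comp_linear_mem_mlpSpace {g : (Fin m → ℝ) → Fin n → ℝ} (hg : g ∈ mlpSpace a m n)
    (A : (Fin l → ℝ) →ₗ[ℝ] (Fin m → ℝ)) : (fun v => g (A v)) ∈ mlpSpace a l n := by
  obtain ⟨N, rfl⟩ := hg
  refine ⟨⟨N.width, N.W₁ * A.toMatrix', N.b₁, N.W₂, N.b₂⟩, ?_⟩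
  ext v c
  simp [MLP.eval, ← Matrix.mulVec_mulVec, ← Matrix.toLin'_apply A.toMatrix']

lemma leakyReLU_eq_max_add (a t : ℝ) : leakyReLU a t = max t 0 + a * min t 0 := by
  unfold leakyReLU
  split_ifs with h
  · simp [h]
  · simp [(not_le.1 h).le]

lemma continuous_leakyReLU (a : ℝ) : Continuous (leakyReLU a) := by
  rw [funext (leakyReLU_eq_max_add a)]
  fun_prop

lemma continuous_of_mem_mlpSpace {g : (Fin m → ℝ) → Fin n → ℝ} (hg : g ∈ mlpSpace a m n) :
    Continuous g := by
  obtain ⟨N, rfl⟩ := hg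
  have := continuous_leakyReLU a
  unfold MLP.eval
  fun_prop

/-- For slope `|a| < 1` the ordinary ReLU is a combination of two leaky ones:
`σ(t) + a σ(-t) = (1 - a²) max(t, 0)`. -/
lemma max_ridge_mem_mlpSpace (ha₀ : 0 ≤ a) (ha₁ : a < 1) (w : Fin m → ℝ) (b : ℝ) :
    (fun v _ => max (w ⬝ᵥ v + b) 0) ∈ mlpSpace a m 1 := by
  have h : (fun (v : Fin m → ℝ) (_ : Fin 1) => max (w ⬝ᵥ v + b) 0) = (1 - a ^ 2)⁻¹ •
      ((fun (v : Fin m → ℝ) (_ : Fin 1) => leakyReLU a (w ⬝ᵥ v + b)) +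
        a • fun (v : Fin m → ℝ) (_ : Fin 1) => leakyReLU a (-w ⬝ᵥ v + -b)) := by
    have h0 : 1 - a ^ 2 ≠ 0 := by nlinarith
    ext v c
    simp only [Pi.smul_apply, Pi.add_apply, smul_eq_mul, neg_dotProduct, ← neg_add,
      leakyReLU_eq_max_add]
    generalize w ⬝ᵥ v + b = t
    rw [eq_inv_mul_iff_mul_eq₀ h0]
    rcases le_total 0 t with ht | ht
    · rw [max_eq_left ht, min_eq_right ht, max_eq_right (by linarith), min_eq_left (by linarith)]
      ring
    · rw [max_eq_right ht, min_eq_left ht, max_eq_left (by linarith), min_eq_right (by linarith)]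
      ring
  rw [h]
  exact Submodule.smul_mem _ _ (Submodule.add_mem _ (leakyReLU_ridge_mem_mlpSpace _ _)
    (Submodule.smul_mem _ _ (leakyReLU_ridge_mem_mlpSpace _ _)))

/-! ### Universal approximation by perceptrons -/

/-- The piecewise linear interpolation of `G : ℕ → ℝ` as a sum of ramps,
constant to the left of `0` and to the right of `N`. -/
def interpolate (G : ℕ → ℝ) (N : ℕ) (s : ℝ) : ℝ :=
  G 0 + ∑ j ∈ Finset.range N, (G (j + 1) - G j) * (max (s - j) 0 - max (s - j - 1) 0)

lemma interpolate_succ (G : ℕ → ℝ) (N : ℕ) (s : ℝ) : interpolate G (N + 1) s =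
    interpolate G N s + (G (N + 1) - G N) * (max (s - N) 0 - max (s - N - 1) 0) := by
  simp [interpolate, Finset.sum_range_succ, add_assoc]

lemma interpolate_of_le (G : ℕ → ℝ) (N : ℕ) {s : ℝ} (hs : N ≤ s) : interpolate G N s = G N := by
  induction N with
  | zero => simp [interpolate]
  | succ N ih =>
    push_cast at hs
    rw [interpolate_succ, ih (by linarith), max_eq_left (by linarith), max_eq_left (by linarith)]
    ring

lemma interpolate_eq (G : ℕ → ℝ) {N : ℕ} (hN : 0 < N) {s : ℝ} (hs₀ : 0 ≤ s) (hs : s ≤ N) :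
    ∃ j < N, j ≤ s ∧ s ≤ j + 1 ∧ interpolate G N s = G j + (G (j + 1) - G j) * (s - j) := by
  induction N with
  | zero => simp at hN
  | succ N ih =>
    push_cast at hs
    rcases le_or_gt (N : ℝ) s with h | h
    · refine ⟨N, by omega, h, hs, ?_⟩
      rw [interpolate_succ, interpolate_of_le G N h, max_eq_left (by linarith),
        max_eq_right (by linarith)]
      ring
    · have hN' : 0 < N := by
        rcases Nat.eq_zero_or_pos N with rfl | h'
        · simp at h; linarith
        · exact h'
      obtain ⟨j, hj, h1, h2, h3⟩ := ih hN' h.le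
      refine ⟨j, by omega, h1, h2, ?_⟩
      rw [interpolate_succ, h3, max_eq_right (by linarith), max_eq_right (by linarith)]
      ring

/-- A continuous function of one variable is uniformly close on an interval to its piecewise linear
interpolation at sufficiently many equidistant nodes. -/
lemma exists_interpolate_near {g : ℝ → ℝ} (hg : Continuous g) {ε : ℝ} (hε : 0 < ε) :
    ∃ N : ℕ, ∀ t ∈ Icc (0 : ℝ) 1, |interpolate (fun j => g (j / N)) N (N * t) - g t| ≤ ε := by
  have huc := (isCompact_Icc (a := (0 : ℝ)) (b := 1)).uniformContinuousOn_of_continuous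
    hg.continuousOn
  obtain ⟨δ, hδ, huc⟩ := Metric.uniformContinuousOn_iff.1 huc ε hε
  obtain ⟨N, hN⟩ := exists_nat_gt (1 / δ)
  have hN0 : (0 : ℝ) < N := lt_trans (by positivity) hN
  have hNδ : 1 / (N : ℝ) < δ := by
    rw [div_lt_iff₀ hδ] at hN; rw [div_lt_iff₀ hN0]; linarith
  refine ⟨N, fun t ht => ?_⟩
  obtain ⟨j, hj, h1, h2, h3⟩ := interpolate_eq (fun j => g (j / N)) (by exact_mod_cast hN0)
    (s := N * t) (mul_nonneg hN0.le ht.1) (by nlinarith [ht.2])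
  have hjN : (j : ℝ) + 1 ≤ N := by exact_mod_cast hj
  have hu : (j : ℝ) / N ≤ t := by rw [div_le_iff₀ hN0]; linarith
  have hv : t ≤ ((j : ℝ) + 1) / N := by rw [le_div_iff₀ hN0]; linarith
  have huv : ((j : ℝ) + 1) / N = j / N + 1 / N := add_div _ _ _
  have hu0 : (0 : ℝ) ≤ (j : ℝ) / N := by positivity
  have hv1 : ((j : ℝ) + 1) / N ≤ 1 := by rw [div_le_one hN0]; exact hjN
  have e1 := huc (j / N) ⟨hu0, by linarith [ht.2]⟩ t ht (by
    rw [Real.dist_eq, abs_lt]; constructor <;> linarith)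
  have e2 := huc ((j + 1) / N) ⟨by linarith [ht.1], hv1⟩ t ht (by
    rw [Real.dist_eq, abs_lt]; constructor <;> linarith)
  rw [Real.dist_eq, abs_lt] at e1 e2
  rw [h3]
  push_cast
  -- the interpolated value is a convex combination of the values at the two neighbouring nodes
  have hc : g (j / N) + (g ((j + 1) / N) - g (j / N)) * (N * t - j) - g t =
    (1 - (N * t - j)) * (g (j / N) - g t) + (N * t - j) * (g ((j + 1) / N) - g t) := by ring
  rw [hc, abs_le]
  constructor <;> nlinarith

lemma ridge_interpolate_mem_mlpSpace (ha₀ : 0 ≤ a) (ha₁ : a < 1) (G : ℕ → ℝ) (N : ℕ)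
    (w : Fin m → ℝ) (b : ℝ) :
    (fun v _ => interpolate G N (w ⬝ᵥ v + b)) ∈ mlpSpace a m 1 := by
  induction N with
  | zero => simpa [interpolate] using const_mem_mlpSpace (a := a) (m := m) (n := 1) fun _ => G 0
  | succ N ih =>
    have h : (fun (v : Fin m → ℝ) (_ : Fin 1) => interpolate G (N + 1) (w ⬝ᵥ v + b)) =
        (fun (v : Fin m → ℝ) (_ : Fin 1) => interpolate G N (w ⬝ᵥ v + b)) + (G (N + 1) - G N) •
        ((fun (v : Fin m → ℝ) (_ : Fin 1) => max (w ⬝ᵥ v + (b - N)) 0) -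
          fun (v : Fin m → ℝ) (_ : Fin 1) => max (w ⬝ᵥ v + (b - N - 1)) 0) := by
      ext v c
      simp only [interpolate_succ, Pi.add_apply, Pi.smul_apply, Pi.sub_apply, smul_eq_mul]
      ring_nf
    rw [h]
    exact add_mem ih (Submodule.smul_mem _ _
      (sub_mem (max_ridge_mem_mlpSpace ha₀ ha₁ _ _) (max_ridge_mem_mlpSpace ha₀ ha₁ _ _)))

lemma exists_mlp_near_ridge (ha₀ : 0 ≤ a) (ha₁ : a < 1) {K : Set (Fin m → ℝ)} (hK : IsCompact K)
    {g : ℝ → ℝ} (hg : Continuous g) (w : Fin m → ℝ) {ε : ℝ} (hε : 0 < ε) :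
    ∃ h ∈ mlpSpace a m 1, ∀ v ∈ K, |h v 0 - g (w ⬝ᵥ v)| ≤ ε := by
  obtain ⟨R, hR⟩ := hK.exists_bound_of_continuousOn (f := fun v => w ⬝ᵥ v)
    (by fun_prop)
  set R' := max R 1 with hR'
  have hR0 : 0 < R' := lt_of_lt_of_le one_pos (le_max_right _ _)
  -- the interval `[-R', R']` is rescaled to `[0, 1]`
  obtain ⟨N, hN⟩ := exists_interpolate_near (g := fun t => g (2 * R' * t - R'))
    (by fun_prop) hε
  refine ⟨_, ridge_interpolate_mem_mlpSpace ha₀ ha₁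
    (fun j : ℕ => g (2 * R' * (j / N) - R')) N (((N : ℝ) / (2 * R')) • w) (N / 2), fun v hv => ?_⟩
  have hb := (hR v hv).trans (le_max_left R 1)
  rw [← hR', Real.norm_eq_abs, abs_le] at hb
  have key := hN ((w ⬝ᵥ v + R') / (2 * R')) ⟨div_nonneg (by linarith) (by linarith), by
    rw [div_le_one (by linarith)]; linarith⟩
  have h1 : 2 * R' * ((w ⬝ᵥ v + R') / (2 * R')) - R' = w ⬝ᵥ v := by field_simp; ring
  have h2 : ((N : ℝ) / (2 * R')) • w ⬝ᵥ v + N / 2 = N * ((w ⬝ᵥ v + R') / (2 * R')) := by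
    rw [smul_dotProduct, smul_eq_mul]; field_simp
  simp only [h1] at key
  simpa only [h2] using key

/-- The exponential ridge functions `v ↦ exp (w ⬝ᵥ v)`, closed under multiplication. -/
def expRidge (m : ℕ) : Submonoid C(Fin m → ℝ, ℝ) where
  carrier := {q | ∃ w : Fin m → ℝ, ∀ v, q v = Real.exp (w ⬝ᵥ v)}
  one_mem' := ⟨0, by simp⟩
  mul_mem' := by
    rintro q q' ⟨w, h⟩ ⟨w', h'⟩
    exact ⟨w + w', fun v => by simp [h, h', add_dotProduct, Real.exp_add]⟩

lemma separatesPoints_adjoin_expRidge (m : ℕ) :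
    (Algebra.adjoin ℝ (expRidge m : Set C(Fin m → ℝ, ℝ))).SeparatesPoints := by
  intro u v huv
  obtain ⟨c, hc⟩ := Function.ne_iff.1 huv
  refine ⟨_, ⟨⟨fun v => Real.exp (Pi.single c 1 ⬝ᵥ v), by fun_prop⟩,
    Algebra.subset_adjoin ⟨Pi.single c 1, fun v => rfl⟩, rfl⟩, ?_⟩
  simpa using hc

/-- Scalar universal approximation. By the Stone-Weierstrass theorem linear combinations of
exponential ridge functions are dense, and each of them reduces to one variable. -/
lemma exists_mlp_near_scalar (ha₀ : 0 ≤ a) (ha₁ : a < 1) {K : Set (Fin m → ℝ)} (hK : IsCompact K)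
    {g : (Fin m → ℝ) → ℝ} (hg : Continuous g) {ε : ℝ} (hε : 0 < ε) :
    ∃ h ∈ mlpSpace a m 1, ∀ v ∈ K, |h v 0 - g v| ≤ ε := by
  obtain ⟨q, hq, hqg⟩ :=
    ContinuousMap.exists_mem_subalgebra_near_continuous_of_isCompact_of_separatesPoints
      (separatesPoints_adjoin_expRidge m) ⟨g, hg⟩ hK (half_pos hε)
  have hspan : q ∈ Submodule.span ℝ (expRidge m : Set C(Fin m → ℝ, ℝ)) := by
    rwa [← Subalgebra.mem_toSubmodule, Algebra.adjoin_eq_span, Submonoid.closure_eq] at hq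
  have hnear : ∀ ε > 0, ∃ h ∈ mlpSpace a m 1, ∀ v ∈ K, |h v 0 - q v| ≤ ε := by
    clear hq hqg
    induction hspan using Submodule.span_induction with
    | mem q hq =>
      intro ε hε
      obtain ⟨w, hw⟩ := hq
      simp only [hw]
      exact exists_mlp_near_ridge ha₀ ha₁ hK Real.continuous_exp w hε
    | zero => exact fun ε hε => ⟨0, zero_mem _, by simp [hε.le]⟩
    | add q q' _ _ ih ih' =>
      intro ε hε
      obtain ⟨h, hh, H⟩ := ih (ε / 2) (half_pos hε)
      obtain ⟨h', hh', H'⟩ := ih' (ε / 2) (half_pos hε)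
      refine ⟨h + h', add_mem hh hh', fun v hv => ?_⟩
      calc |(h + h') v 0 - (q + q') v| = |(h v 0 - q v) + (h' v 0 - q' v)| := by
            simp only [Pi.add_apply, ContinuousMap.add_apply]; ring_nf
        _ ≤ ε := (abs_add_le _ _).trans (by linarith [H v hv, H' v hv])
    | smul s q _ ih =>
      intro ε hε
      obtain ⟨h, hh, H⟩ := ih (ε / (|s| + 1)) (by positivity)
      refine ⟨s • h, Submodule.smul_mem _ _ hh, fun v hv => ?_⟩
      calc |(s • h) v 0 - (s • q) v| = |s| * |h v 0 - q v| := by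
            simp only [Pi.smul_apply, ContinuousMap.smul_apply, smul_eq_mul, ← abs_mul]; ring_nf
        _ ≤ (|s| + 1) * (ε / (|s| + 1)) := by
            gcongr
            · linarith
            · exact H v hv
        _ = ε := by field_simp
  obtain ⟨h, hh, H⟩ := hnear (ε / 2) (half_pos hε)
  refine ⟨h, hh, fun v hv => ?_⟩
  have h1 := hqg v hv
  rw [Real.norm_eq_abs] at h1
  calc |h v 0 - g v| ≤ |h v 0 - q v| + |q v - g v| := abs_sub_le _ _ _
    _ ≤ ε := by linarith [H v hv, show |q v - g v| < ε / 2 from h1]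

/-- Universal approximation: perceptrons with one hidden layer are dense in the continuous maps
`ℝᵐ → ℝⁿ`, uniformly on compact sets. -/
theorem exists_mlp_near (ha₀ : 0 ≤ a) (ha₁ : a < 1) {K : Set (Fin m → ℝ)} (hK : IsCompact K)
    {g : (Fin m → ℝ) → Fin n → ℝ} (hg : Continuous g) {ε : ℝ} (hε : 0 < ε) :
    ∃ h ∈ mlpSpace a m n, ∀ v ∈ K, ‖h v - g v‖ ≤ ε := by
  choose h hh H using fun c : Fin n =>
    exists_mlp_near_scalar ha₀ ha₁ hK ((continuous_pi_iff.1 hg) c) hε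
  refine ⟨∑ c, fun v => LinearMap.single ℝ (fun _ : Fin n => ℝ) c (h c v 0), ?_, fun v hv => ?_⟩
  · exact sum_mem fun c _ => linear_comp_mem_mlpSpace (hh c)
      ((LinearMap.single ℝ (fun _ : Fin n => ℝ) c).comp (LinearMap.proj 0))
  · refine (pi_norm_le_iff_of_nonneg hε.le).2 fun c => ?_
    simpa [Finset.sum_apply, Pi.single_apply] using H c v hv

end

/-! ### Symmetric functions as functions of a sum over the points -/

section

/-- Two finite families of points on which all sums `∑ᵢ ψ(xᵢ)`, `ψ` continuous, agree are
permutations of each other: testing against a `ψ` that vanishes at all the points but `z` counts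
the indices `i` with `xᵢ = z`. -/
lemma exists_perm_of_sum_eq {ι E : Type*} [Fintype ι] [MetricSpace E] {x y : ι → E}
    (h : ∀ ψ : E → ℝ, Continuous ψ → ∑ i, ψ (x i) = ∑ i, ψ (y i)) :
    ∃ π : Equiv.Perm ι, ∀ i, x i = y (π i) := by
  classical
  have hcard : ∀ z : E, Fintype.card {i // x i = z} = Fintype.card {i // y i = z} := by
    intro z
    set T : Finset E := (Finset.univ.image x ∪ Finset.univ.image y).erase z with hT
    set ψ : E → ℝ := fun v => ∏ u ∈ T, dist v u with hψ
    have hz : ψ z ≠ 0 := Finset.prod_ne_zero_iff.2 fun u hu =>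
      dist_ne_zero.2 (Finset.ne_of_mem_erase hu).symm
    have hsum : ∀ u : ι → E, (∀ i, u i ≠ z → u i ∈ T) →
        ∑ i, ψ (u i) = Fintype.card {i // u i = z} * ψ z := by
      intro u hu
      have : ∀ i, ψ (u i) = if u i = z then ψ z else 0 := fun i => by
        split_ifs with hi
        · rw [hi]
        · exact Finset.prod_eq_zero (hu i hi) (dist_self _)
      rw [Finset.sum_congr rfl fun i _ => this i, ← Finset.sum_filter, Finset.sum_const,
        nsmul_eq_mul, Fintype.card_subtype]
    have hx := hsum x fun i hi => by simp [hT, hi]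
    have hy := hsum y fun i hi => by simp [hT, hi]
    have := h ψ (by fun_prop)
    rw [hx, hy] at this
    exact_mod_cast mul_right_cancel₀ hz this
  exact ⟨Equiv.ofFiberEquiv fun z => Fintype.equivOfCardEq (hcard z),
    fun i => (Equiv.ofFiberEquiv_map _ i).symm⟩

section

variable {E : Type*} [TopologicalSpace E] {M : ℕ}

/-- The relation on the points of `K ⊆ Eᴹ` that identifies families with the same sums
`∑ᵢ ψ(xᵢ)` for all continuous `ψ`. -/
def sumSetoid (K : Set (Fin M → E)) : Setoid K where
  r x y := ∀ ψ : E → ℝ, Continuous ψ → ∑ i, ψ (x.1 i) = ∑ i, ψ (y.1 i)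
  iseqv := ⟨fun _ _ _ => rfl, fun h ψ hψ => (h ψ hψ).symm,
    fun h h' ψ hψ => (h ψ hψ).trans (h' ψ hψ)⟩

/-- The continuous functions on the quotient of `K` by `sumSetoid` that have the form
`x ↦ ρ (∑ᵢ Φ(xᵢ))` with `Φ` and `ρ` continuous and finitely many features `Φ`. -/
def sumAlgebra (K : Set (Fin M → E)) : Subalgebra ℝ C(Quotient (sumSetoid K), ℝ) where
  carrier := {q | ∃ (ι : Type) (_ : Fintype ι) (Φ : E → ι → ℝ) (ρ : (ι → ℝ) → ℝ),
    Continuous Φ ∧ Continuous ρ ∧ ∀ x : K, q (Quotient.mk _ x) = ρ (∑ i, Φ (x.1 i))}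
  mul_mem' := by
    rintro q q' ⟨ι, _, Φ, ρ, hΦ, hρ, h⟩ ⟨ι', _, Φ', ρ', hΦ', hρ', h'⟩
    refine ⟨ι ⊕ ι', inferInstance, fun v => Sum.elim (Φ v) (Φ' v),
      fun u => ρ (fun s => u (.inl s)) * ρ' (fun s => u (.inr s)), ?_, by fun_prop, fun x => ?_⟩
    · refine continuous_pi fun s => ?_
      cases s <;> simp only [Sum.elim_inl, Sum.elim_inr] <;> fun_prop
    · rw [ContinuousMap.mul_apply, h, h']
      congr 2 <;> ext s <;> simp [Finset.sum_apply]
  add_mem' := by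
    rintro q q' ⟨ι, _, Φ, ρ, hΦ, hρ, h⟩ ⟨ι', _, Φ', ρ', hΦ', hρ', h'⟩
    refine ⟨ι ⊕ ι', inferInstance, fun v => Sum.elim (Φ v) (Φ' v),
      fun u => ρ (fun s => u (.inl s)) + ρ' (fun s => u (.inr s)), ?_, by fun_prop, fun x => ?_⟩
    · refine continuous_pi fun s => ?_
      cases s <;> simp only [Sum.elim_inl, Sum.elim_inr] <;> fun_prop
    · rw [ContinuousMap.add_apply, h, h']
      congr 2 <;> ext s <;> simp [Finset.sum_apply]
  algebraMap_mem' s := ⟨Empty, inferInstance, 0, fun _ => s, by fun_prop, by fun_prop,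
    fun x => rfl⟩

lemma separatesPoints_sumAlgebra (K : Set (Fin M → E)) : (sumAlgebra K).SeparatesPoints := by
  intro x y
  induction x using Quotient.inductionOn with | _ x
  induction y using Quotient.inductionOn with | _ y
  intro hxy
  have hxy' : ¬ ∀ ψ : E → ℝ, Continuous ψ → ∑ i, ψ (x.1 i) = ∑ i, ψ (y.1 i) :=
    fun h => hxy (Quotient.sound h)
  push Not at hxy'
  obtain ⟨ψ, hψ, hne⟩ := hxy'
  have hcont : Continuous fun x : K => ∑ i, ψ (x.1 i) :=
    continuous_finsetSum _ fun i _ =>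
      hψ.comp ((continuous_apply i).comp continuous_subtype_val)
  refine ⟨_, ⟨⟨Quotient.lift (fun x : K => ∑ i, ψ (x.1 i)) fun x y h => h ψ hψ,
    hcont.quotient_lift _⟩, ⟨Unit, inferInstance, fun v _ => ψ v, fun u => u (),
      by fun_prop, by fun_prop, fun x => ?_⟩, rfl⟩, hne⟩
  simp [Finset.sum_apply]

end

variable {E : Type*} [MetricSpace E] {M : ℕ}

lemma exists_sum_near_scalar {K : Set (Fin M → E)} (hK : IsCompact K) {f : (Fin M → E) → ℝ}
    (hf : Continuous f)
    (hperm : ∀ (π : Equiv.Perm (Fin M)) (x : Fin M → E), f (fun i => x (π i)) = f x)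
    {ε : ℝ} (hε : 0 < ε) :
    ∃ (ι : Type) (_ : Fintype ι) (Φ : E → ι → ℝ) (ρ : (ι → ℝ) → ℝ),
      Continuous Φ ∧ Continuous ρ ∧ ∀ x ∈ K, |ρ (∑ i, Φ (x i)) - f x| ≤ ε := by
  have : CompactSpace K := isCompact_iff_compactSpace.1 hK
  have hlift : ∀ x y : K, sumSetoid K x y → f x = f y := by
    intro x y h
    obtain ⟨π, hπ⟩ := exists_perm_of_sum_eq h
    rw [← hperm π y, ← funext hπ]
  obtain ⟨⟨q, ι, _, Φ, ρ, hΦ, hρ, h⟩, hq⟩ :=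
    ContinuousMap.exists_mem_subalgebra_near_continuous_of_separatesPoints (sumAlgebra K)
      (separatesPoints_sumAlgebra K) (Quotient.lift (fun x : K => f x) hlift)
      ((hf.comp continuous_subtype_val).quotient_lift _) ε hε
  refine ⟨ι, inferInstance, Φ, ρ, hΦ, hρ, fun x hx => ?_⟩
  rw [← h ⟨x, hx⟩]
  exact (hq (Quotient.mk _ ⟨x, hx⟩)).le

/-- On a compact set, a continuous symmetric function is uniformly close to a continuous function
of finitely many averages `1/M ∑ᵢ Φ(xᵢ)`. -/
theorem exists_mean_near {p : ℕ} {K : Set (Fin M → E)} (hK : IsCompact K)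
    {f : (Fin M → E) → Fin p → ℝ} (hf : Continuous f)
    (hperm : ∀ (π : Equiv.Perm (Fin M)) (x : Fin M → E), f (fun i => x (π i)) = f x)
    {ε : ℝ} (hε : 0 < ε) :
    ∃ (r : ℕ) (Φ : E → Fin r → ℝ) (ρ : (Fin r → ℝ) → Fin p → ℝ),
      Continuous Φ ∧ Continuous ρ ∧
        ∀ x ∈ K, ‖ρ ((1 / (M : ℝ)) • ∑ i, Φ (x i)) - f x‖ ≤ ε := by
  choose ι _ Φ ρ hΦ hρ H using fun c : Fin p =>
    exists_sum_near_scalar hK ((continuous_pi_iff.1 hf) c)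
      (fun π x => congrFun (hperm π x) c) hε
  let e := Fintype.equivFin (Σ c, ι c)
  have hF (v : E) (c : Fin p) (s : ι c) :
      Φ (e.symm (e ⟨c, s⟩)).1 v (e.symm (e ⟨c, s⟩)).2 = Φ c v s := by
    rw [Equiv.symm_apply_apply]
  refine ⟨_, fun v s => Φ (e.symm s).1 v (e.symm s).2,
    fun u c => ρ c fun s => M * u (e ⟨c, s⟩), ?_, by fun_prop, fun x hx => ?_⟩
  · exact continuous_pi fun s => (continuous_pi_iff.1 (hΦ _)) _
  · refine (pi_norm_le_iff_of_nonneg hε.le).2 fun c => ?_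
    have harg : (fun s => (M : ℝ) * ((1 / (M : ℝ)) • ∑ i, fun t =>
        Φ (e.symm t).1 (x i) (e.symm t).2) (e ⟨c, s⟩)) = ∑ i, Φ c (x i) := by
      ext s
      simp only [Pi.smul_apply, Finset.sum_apply, hF, smul_eq_mul]
      rcases Nat.eq_zero_or_pos M with rfl | hM
      · simp
      · field_simp
    simpa only [Pi.sub_apply, harg, Real.norm_eq_abs] using H c x hx

end

section

variable {a : ℝ} {M d p : ℕ}

/-- Mean pooling of perceptron features followed by a perceptron: in `exists_mean_near` both
continuous maps are replaced by perceptrons, first the outer one on a ball that contains all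
averages with a margin, then the inner one. -/
theorem exists_mlp_mean_near (ha₀ : 0 ≤ a) (ha₁ : a < 1)
    {K : Set (Fin M → EuclideanSpace ℝ (Fin d))} (hK : IsCompact K)
    {f : (Fin M → EuclideanSpace ℝ (Fin d)) → Fin p → ℝ} (hf : Continuous f)
    (hperm : ∀ (π : Equiv.Perm (Fin M)) (x : Fin M → EuclideanSpace ℝ (Fin d)),
      f (fun i => x (π i)) = f x) {ε : ℝ} (hε : 0 < ε) :
    ∃ (r : ℕ), ∃ φ ∈ mlpSpace a d r, ∃ ρ ∈ mlpSpace a r p,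
      ∀ x ∈ K, ‖ρ ((1 / (M : ℝ)) • ∑ i, φ (x i).ofLp) - f x‖ ≤ ε := by
  obtain ⟨r, Φ, ρ₀, hΦ, hρ₀, H⟩ := exists_mean_near hK hf hperm (ε := ε / 3) (by positivity)
  obtain ⟨R, hR⟩ := hK.exists_bound_of_continuousOn
    (f := fun x => (1 / (M : ℝ)) • ∑ i, Φ (x i)) (by fun_prop)
  have hball := isCompact_closedBall (0 : Fin r → ℝ) (R + 1)
  obtain ⟨ρ, hρ, Hρ⟩ := exists_mlp_near ha₀ ha₁ hball hρ₀ (ε := ε / 3) (by positivity)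
  obtain ⟨δ, hδ, Hδ⟩ := Metric.uniformContinuousOn_iff.1
    (hball.uniformContinuousOn_of_continuous hρ₀.continuousOn) (ε / 3) (by positivity)
  have hcomp : IsCompact (⋃ i, (fun x : Fin M → EuclideanSpace ℝ (Fin d) => (x i).ofLp) '' K) :=
    isCompact_iUnion fun i => hK.image (by fun_prop)
  have hmin : 0 < min (δ / 2) 1 := by positivity
  obtain ⟨φ, hφ, Hφ⟩ := exists_mlp_near ha₀ ha₁ hcomp (g := fun v => Φ (WithLp.toLp 2 v))
    (by fun_prop) hmin
  refine ⟨r, φ, hφ, ρ, hρ, fun x hx => ?_⟩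
  set u := (1 / (M : ℝ)) • ∑ i, φ (x i).ofLp with hu
  set u₀ := (1 / (M : ℝ)) • ∑ i, Φ (x i) with hu₀
  have hdist : ‖u - u₀‖ ≤ min (δ / 2) 1 := by
    rw [hu, hu₀, ← smul_sub, ← Finset.sum_sub_distrib, norm_smul]
    have h1 : ‖∑ i, (φ (x i).ofLp - Φ (x i))‖ ≤ M * min (δ / 2) 1 := by
      refine (norm_sum_le_of_le Finset.univ (f := fun i => φ (x i).ofLp - Φ (x i))
        (n := fun _ => min (δ / 2) 1) fun i _ => ?_).trans (by simp)
      exact Hφ _ (mem_iUnion.2 ⟨i, x, hx, rfl⟩)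
    rcases Nat.eq_zero_or_pos M with rfl | hM
    · simp [hmin.le]
    · have hM' : (0 : ℝ) < M := by exact_mod_cast hM
      rw [Real.norm_of_nonneg (by positivity), one_div, inv_mul_le_iff₀ hM']
      exact h1
  have hu₀R : ‖u₀‖ ≤ R := hR x hx
  have huR : ‖u‖ ≤ R + 1 := by
    have := norm_add_le u₀ (u - u₀)
    rw [add_sub_cancel] at this
    linarith [hdist.trans (min_le_right _ _)]
  have h1 := Hρ u (by simpa using huR)
  have h2 := Hδ u (by simpa using huR) u₀ (by simp; linarith) (by
    rw [dist_eq_norm]; linarith [hdist.trans (min_le_left _ _)])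
  have h3 : ‖ρ₀ u₀ - f x‖ ≤ ε / 3 := H x hx
  rw [dist_eq_norm] at h2
  have h4 := norm_sub_le_norm_sub_add_norm_sub (ρ u) (ρ₀ u) (f x)
  have h5 := norm_sub_le_norm_sub_add_norm_sub (ρ₀ u) (ρ₀ u₀) (f x)
  linarith

/-! ### Doubling the features -/

/-- The features `u` together with their negatives: a vector with coordinate sum `0`, and one from
which `u` can be recovered after a leaky ReLU. -/
def double (r : ℕ) : (Fin r → ℝ) →ₗ[ℝ] (Fin (r + r) → ℝ) where
  toFun u := Fin.append u (-u)
  map_add' u v := by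
    ext c
    refine Fin.addCases (fun c => ?_) (fun c => ?_) c <;>
      simp only [Pi.add_apply, Pi.neg_apply, Fin.append_left, Fin.append_right, neg_add]
  map_smul' s u := by
    ext c
    refine Fin.addCases (fun c => ?_) (fun c => ?_) c <;>
      simp only [Pi.smul_apply, Pi.neg_apply, Fin.append_left, Fin.append_right, smul_neg,
        RingHom.id_apply]

lemma double_castAdd {r : ℕ} (u : Fin r → ℝ) (c : Fin r) : double r u (Fin.castAdd r c) = u c :=
  Fin.append_left ..

lemma double_natAdd {r : ℕ} (u : Fin r → ℝ) (c : Fin r) : double r u (Fin.natAdd r c) = -u c :=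
  Fin.append_right ..

/-- Half the difference of the two blocks of coordinates, a left inverse of `double`. -/
def undouble (r : ℕ) : (Fin (r + r) → ℝ) →ₗ[ℝ] (Fin r → ℝ) :=
  (2⁻¹ : ℝ) • (LinearMap.funLeft ℝ ℝ (Fin.castAdd r) - LinearMap.funLeft ℝ ℝ (Fin.natAdd r))

lemma undouble_apply {r : ℕ} (u : Fin (r + r) → ℝ) (c : Fin r) :
    undouble r u c = 2⁻¹ * (u (Fin.castAdd r c) - u (Fin.natAdd r c)) := by
  simp [undouble, LinearMap.funLeft_apply]

lemma undouble_double {r : ℕ} (u : Fin r → ℝ) : undouble r (double r u) = u := by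
  ext c
  rw [undouble_apply, double_castAdd, double_natAdd]
  ring

lemma sum_double {r : ℕ} (u : Fin r → ℝ) : ∑ c, double r u c = 0 := by
  simp only [Fin.sum_univ_add, double_castAdd, double_natAdd, Finset.sum_neg_distrib,
    add_neg_cancel]

/-- `σ(t) - σ(-t) = (1 + a) t` for the leaky ReLU, in every feature. -/
lemma undouble_leakyReLU_double {r : ℕ} (u : Fin r → ℝ) :
    undouble r (fun c => leakyReLU a (double r u c)) = ((1 + a) / 2) • u := by
  ext c
  have h : leakyReLU a (u c) - leakyReLU a (-u c) = (1 + a) * u c := by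
    simp only [leakyReLU_eq_max_add]
    rcases le_total 0 (u c) with ht | ht
    · rw [max_eq_left ht, min_eq_right ht, max_eq_right (by linarith), min_eq_left (by linarith)]
      ring
    · rw [max_eq_right ht, min_eq_left ht, max_eq_left (by linarith), min_eq_right (by linarith)]
      ring
  rw [undouble_apply, double_castAdd, double_natAdd, h, Pi.smul_apply, smul_eq_mul]
  ring

/-! ### Euclidean norms and uniform errors -/

lemma norm_toLp_sub_le {ε : ℝ} {u : Fin p → ℝ} {y : EuclideanSpace ℝ (Fin p)}
    (h : ‖u - y.ofLp‖ ≤ ε) : ‖WithLp.toLp 2 u - y‖ ≤ p * ε := by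
  have h1 : WithLp.toLp 2 u - y =
      ∑ c, EuclideanSpace.single c (u c - y c) := by
    ext c
    simp [Finset.sum_apply, Pi.single_apply]
  rw [h1]
  refine (norm_sum_le_of_le (n := fun _ => ε) _ fun c _ => ?_).trans (by simp)
  rw [PiLp.norm_single]
  exact (norm_le_pi_norm (u - y.ofLp) c).trans h

lemma iSup_enorm_lt {X : Type*} {K : Set X} {F : X → EuclideanSpace ℝ (Fin p)} {ε : ℝ}
    (hε : 0 < ε) (h : ∀ x ∈ K, ‖F x‖ ≤ ε / 2) : (⨆ x ∈ K, ‖F x‖ₑ) < ENNReal.ofReal ε := by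
  refine lt_of_le_of_lt (iSup₂_le fun x hx => ?_)
    ((ENNReal.ofReal_lt_ofReal_iff hε).2 (half_lt_self hε))
  rw [← ofReal_norm]
  exact ENNReal.ofReal_le_ofReal (h x hx)

/-! ### Iterated layer normalization near the origin -/

variable {w : ℕ} {η : ℝ}

/-- Layer normalization of mean-zero vectors, rescaled so as to magnify a neighbourhood of the
origin: `layerNorm η (δ v) = δ • rescaledNorm η δ v`. At `δ = 0` it is multiplication by
`1 / √η`. -/
def rescaledNorm (η δ : ℝ) (v : Fin w → ℝ) : Fin w → ℝ :=
  (Real.sqrt (δ ^ 2 * var v + η))⁻¹ • v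

lemma mean_eq_zero {v : Fin w → ℝ} (hv : ∑ c, v c = 0) : mean v = 0 := by simp [mean, hv]

lemma layerNorm_smul (δ : ℝ) {v : Fin w → ℝ} (hv : ∑ c, v c = 0) :
    layerNorm η (δ • v) = δ • rescaledNorm η δ v := by
  have h0 : mean (δ • v) = 0 := mean_eq_zero (by simp [← Finset.mul_sum, hv])
  have h1 : var (δ • v) = δ ^ 2 * var v := by
    simp only [var, h0, mean_eq_zero hv, sub_zero, Pi.smul_apply, smul_eq_mul, mul_pow,
      ← Finset.mul_sum]
    ring
  ext c
  simp only [layerNorm, h0, h1, rescaledNorm, Pi.smul_apply, smul_eq_mul]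
  ring

lemma layerNorm_iterate_smul (D : ℕ) (δ : ℝ) {v : Fin w → ℝ} (hv : ∑ c, v c = 0) :
    (layerNorm η)^[D] (δ • v) = δ • (rescaledNorm η δ)^[D] v := by
  induction D generalizing v with
  | zero => rfl
  | succ D ih =>
    rw [Function.iterate_succ_apply, Function.iterate_succ_apply, layerNorm_smul δ hv, ih]
    simp [rescaledNorm, ← Finset.mul_sum, hv]

lemma rescaledNorm_zero_iterate (D : ℕ) (v : Fin w → ℝ) :
    (rescaledNorm η 0)^[D] v = (Real.sqrt η)⁻¹ ^ D • v := by
  induction D with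
  | zero => simp
  | succ D ih =>
    rw [Function.iterate_succ_apply', ih, rescaledNorm, smul_smul, zero_pow two_ne_zero,
      zero_mul, zero_add, ← pow_succ']

lemma var_nonneg (v : Fin w → ℝ) : 0 ≤ var v := by
  unfold var
  positivity

lemma continuous_rescaledNorm_iterate (hη : 0 < η) (D : ℕ) :
    Continuous fun q : ℝ × (Fin w → ℝ) => (rescaledNorm η q.1)^[D] q.2 := by
  induction D with
  | zero => exact continuous_snd
  | succ D ih =>
    simp only [Function.iterate_succ_apply']
    have hvar : Continuous (var : (Fin w → ℝ) → ℝ) := by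
      unfold var mean
      fun_prop
    have hpos (q : ℝ × (Fin w → ℝ)) :
        Real.sqrt (q.1 ^ 2 * var ((rescaledNorm η q.1)^[D] q.2) + η) ≠ 0 := by
      have := var_nonneg ((rescaledNorm η q.1)^[D] q.2)
      positivity
    refine Continuous.smul (Continuous.inv₀ ?_ hpos) ih
    exact Real.continuous_sqrt.comp
      (((continuous_fst.pow 2).mul (hvar.comp ih)).add continuous_const)

end

/-! ### Networks with uniform attention -/

section

variable {a η : ℝ} {M d p H k w : ℕ}

lemma softmax_zero (i : Fin M) : softmax (fun _ => 0) i = 1 / (M : ℝ) := by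
  simp [softmax]

namespace ResidualWeights

/-- The network without messages and with uniform read-out: all attention weights, the layer
weights and the read-out query are `0`. -/
def uniform (enc : MLP d w) (head : MLP w p) : ResidualWeights d p w H k where
  enc := enc
  Wq := 0
  Wk := 0
  Wg := 0
  qF := 0
  head := head

lemma eval_uniform (D : ℕ) (enc : MLP d w) (head : MLP w p)
    (x : Fin M → EuclideanSpace ℝ (Fin d)) :
    (uniform enc head : ResidualWeights d p w H k).eval a η D x =
      WithLp.toLp 2 (head.eval a ((1 / (M : ℝ)) •
        ∑ i, (layerNorm η)^[D] (enc.eval a (x i).ofLp))) := by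
  have hstates (h : Fin M → Fin w → ℝ) (α : Fin H → Fin M → Fin M → ℝ) :
      ((uniform enc head : ResidualWeights d p w H k).layer η α)^[D] h =
        fun i => (layerNorm η)^[D] (h i) := by
    induction D with
    | zero => rfl
    | succ D ih =>
      rw [Function.iterate_succ_apply', ih]
      ext i c
      rw [layer, Function.iterate_succ_apply']
      simp [uniform]
  rw [eval, states, hstates, readOut]
  simp [uniform, softmax_zero, ← Finset.smul_sum]

end ResidualWeights

namespace BlockWeights

/-- The block with uniform attention: all attention weights are `0`. -/
def uniform (value : MLP d w) (out : MLP w p) : BlockWeights d p w H k where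
  Wq := 0
  Wk := 0
  value := value
  out := out

lemma eval_uniform (hH : 1 ≤ H) (value : MLP d w) (out : MLP w p)
    (x : Fin M → EuclideanSpace ℝ (Fin d)) :
    (uniform value out : BlockWeights d p w H k).eval a x =
      WithLp.toLp 2 (out.eval a fun c => leakyReLU a
        (((1 / (M : ℝ)) • ∑ i, value.eval a (x i).ofLp) c)) := by
  have hH' : (H : ℝ) ≠ 0 := by exact_mod_cast (by omega : H ≠ 0)
  have hsum : (uniform value out : BlockWeights d p w H k).attnSum a (fun i => (x i).ofLp) =
      (1 / (M : ℝ)) • ∑ i, value.eval a (x i).ofLp := by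
    rw [attnSum]
    simp only [uniform, Pi.zero_apply, Matrix.zero_mulVec, dotProduct_zero, softmax_zero,
      ← Finset.smul_sum, Finset.sum_const, Finset.card_univ, Fintype.card_fin,
      ← Nat.cast_smul_eq_nsmul ℝ, smul_smul]
    field_simp
  rw [eval, hsum]
  rfl

end BlockWeights

/-! ### Realizing mean pooling -/

/-- A mean-pooling network `x ↦ ρ (1/M ∑ᵢ φ(xᵢ))` is a uniform limit on compact sets of residual
networks of any depth: the encoder `δ (φ, -φ)` makes layer normalization nearly linear, and the
head undoes the rescaling. -/
theorem exists_residual_near (hη : 0 < η) (D : ℕ) {r : ℕ}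
    {φ : (Fin d → ℝ) → Fin r → ℝ} (hφ : φ ∈ mlpSpace a d r)
    {ρ : (Fin r → ℝ) → Fin p → ℝ} (hρ : ρ ∈ mlpSpace a r p)
    {K : Set (Fin M → EuclideanSpace ℝ (Fin d))} (hK : IsCompact K) {ε : ℝ} (hε : 0 < ε) :
    ∃ (w : ℕ) (θ : ResidualWeights d p w H k), ∀ x ∈ K,
      ‖θ.eval a η D x - WithLp.toLp 2 (ρ ((1 / (M : ℝ)) • ∑ i, φ (x i).ofLp))‖ < ε := by
  set s : ℝ := Real.sqrt η ^ D with hs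
  have hs0 : s ≠ 0 := by positivity
  -- the output of the network below, extended continuously to `δ = 0`
  let F : ℝ → (Fin M → EuclideanSpace ℝ (Fin d)) → EuclideanSpace ℝ (Fin p) := fun δ x =>
    WithLp.toLp 2 (ρ (undouble r (s • (1 / (M : ℝ)) •
      ∑ i, (rescaledNorm η δ)^[D] (double r (φ (x i).ofLp)))))
  have hF0 (x) : F 0 x = WithLp.toLp 2 (ρ ((1 / (M : ℝ)) • ∑ i, φ (x i).ofLp)) := by
    simp only [F, rescaledNorm_zero_iterate, ← Finset.smul_sum, map_smul, map_sum,
      undouble_double]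
    rw [smul_comm _ ((Real.sqrt η)⁻¹ ^ D), smul_smul, inv_pow, ← hs, mul_inv_cancel₀ hs0, one_smul]
  have hφc := continuous_of_mem_mlpSpace hφ
  have hρc := continuous_of_mem_mlpSpace hρ
  have hF : Continuous fun q : ℝ × (Fin M → EuclideanSpace ℝ (Fin d)) => F q.1 q.2 := by
    have hd : Continuous (double r) := (double r).continuous_of_finiteDimensional
    have hu : Continuous (undouble r) := (undouble r).continuous_of_finiteDimensional
    have hi (i : Fin M) : Continuous fun q : ℝ × (Fin M → EuclideanSpace ℝ (Fin d)) =>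
        (rescaledNorm η q.1)^[D] (double r (φ (q.2 i).ofLp)) :=
      (continuous_rescaledNorm_iterate hη D).comp
        (f := fun q : ℝ × (Fin M → EuclideanSpace ℝ (Fin d)) =>
          (q.1, double r (φ (q.2 i).ofLp))) (by fun_prop)
    fun_prop
  have hev : ∀ᶠ δ in 𝓝 (0 : ℝ), ∀ x ∈ K, ‖F δ x - F 0 x‖ < ε := by
    refine hK.eventually_forall_of_forall_eventually fun x _ => ?_
    have hcont : Continuous fun q : ℝ × (Fin M → EuclideanSpace ℝ (Fin d)) =>
        ‖F q.1 q.2 - F 0 q.2‖ :=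
      (hF.sub (hF.comp (continuous_const.prodMk continuous_snd))).norm
    exact hcont.continuousAt.eventually_lt_const (by simpa using hε)
  obtain ⟨δ, hδ, hδ0⟩ :=
    ((hev.filter_mono nhdsWithin_le_nhds).and (self_mem_nhdsWithin (s := {0}ᶜ))).exists
  obtain ⟨enc, henc⟩ := linear_comp_mem_mlpSpace hφ (δ • double r)
  obtain ⟨head, hhead⟩ := comp_linear_mem_mlpSpace hρ ((s * δ⁻¹) • undouble r)
  refine ⟨r + r, ResidualWeights.uniform enc head, fun x hx => ?_⟩
  have hδ' : δ ≠ 0 := hδ0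
  have heval : (ResidualWeights.uniform enc head : ResidualWeights d p _ H k).eval a η D x =
      F δ x := by
    simp only at henc hhead
    simp only [ResidualWeights.eval_uniform, henc, hhead, LinearMap.smul_apply,
      layerNorm_iterate_smul D δ (sum_double _), F, ← Finset.smul_sum, map_smul]
    simp only [smul_smul]
    congr 3
    field_simp
  rw [heval, ← hF0]
  exact hδ x hx

/-- A mean-pooling network is a block with uniform attention and value map `(φ, -φ)`: the
activation between the layers is undone by a linear map. -/
theorem exists_block_eq (ha₀ : 0 ≤ a) (hH : 1 ≤ H) {r : ℕ}
    {φ : (Fin d → ℝ) → Fin r → ℝ} (hφ : φ ∈ mlpSpace a d r)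
    {ρ : (Fin r → ℝ) → Fin p → ℝ} (hρ : ρ ∈ mlpSpace a r p) :
    ∃ (w : ℕ) (θ : BlockWeights d p w H k), ∀ x : Fin M → EuclideanSpace ℝ (Fin d),
      θ.eval a x = WithLp.toLp 2 (ρ ((1 / (M : ℝ)) • ∑ i, φ (x i).ofLp)) := by
  obtain ⟨value, hvalue⟩ := linear_comp_mem_mlpSpace hφ (double r)
  obtain ⟨out, hout⟩ := comp_linear_mem_mlpSpace hρ ((2 / (1 + a)) • undouble r)
  refine ⟨r + r, BlockWeights.uniform value out, fun x => ?_⟩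
  simp only at hvalue hout
  have ha : 2 / (1 + a) * ((1 + a) / 2) = 1 := by
    have : 1 + a ≠ 0 := by positivity
    field_simp
  simp only [BlockWeights.eval_uniform hH, hvalue, hout, ← map_sum, ← map_smul,
    LinearMap.smul_apply, undouble_leakyReLU_double, smul_smul, ← mul_assoc, ha, one_mul]

end

end Clarga

end

theorem proposition1 (M d p : ℕ)
    (f : (Fin M → EuclideanSpace ℝ (Fin d)) → EuclideanSpace ℝ (Fin p))
    (hf : Continuous f)
    (hperm : ∀ (π : Equiv.Perm (Fin M)) (x : Fin M → EuclideanSpace ℝ (Fin d)),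
      f (fun i => x (π i)) = f x)
    (K : Set (Fin M → EuclideanSpace ℝ (Fin d))) (hK : IsCompact K)
    (ε : ℝ) (hε : 0 < ε)
    (H : ℕ) (hH : 1 ≤ H) (k : ℕ)
    (a : ℝ) (ha₀ : 0 ≤ a) (ha₁ : a < 1) (η : ℝ) (hη : 0 < η) :
    (∀ D : ℕ, ∃ (w : ℕ) (θ : Clarga.ResidualWeights d p w H k),
      (⨆ x ∈ K, ‖θ.eval a η D x - f x‖ₑ) < ENNReal.ofReal ε) ∧
    (∃ (r : ℕ) (θ : Clarga.BlockWeights d p r H k),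
      (⨆ x ∈ K, ‖θ.eval a x - f x‖ₑ) < ENNReal.ofReal ε) := by
  obtain ⟨r, φ, hφ, ρ, hρ, h⟩ := Clarga.exists_mlp_mean_near ha₀ ha₁ hK
    (f := fun x => (f x).ofLp) (by fun_prop) (fun π x => by rw [hperm π x])
    (ε := ε / 4 / (p + 1)) (by positivity)
  have hnear : ∀ x ∈ K,
      ‖WithLp.toLp 2 (ρ ((1 / (M : ℝ)) • ∑ i, φ (x i).ofLp)) - f x‖ ≤ ε / 4 := by
    intro x hx
    refine (Clarga.norm_toLp_sub_le (h x hx)).trans ?_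
    rw [mul_div_assoc', div_le_iff₀ (by positivity)]
    linarith
  refine ⟨fun D => ?_, ?_⟩
  · obtain ⟨w, θ, hθ⟩ := Clarga.exists_residual_near (H := H) (k := k) hη D hφ hρ hK
      (ε := ε / 4) (by positivity)
    refine ⟨w, θ, Clarga.iSup_enorm_lt hε fun x hx => ?_⟩
    refine (norm_sub_le_norm_sub_add_norm_sub _ _ _).trans
      ((add_le_add (hθ x hx).le (hnear x hx)).trans (by linarith))
  · obtain ⟨w, θ, hθ⟩ := Clarga.exists_block_eq (M := M) (H := H) (k := k) ha₀ hH hφ hρ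
    refine ⟨w, θ, Clarga.iSup_enorm_lt hε fun x hx => ?_⟩
    rw [hθ]
    linarith [hnear x hx]
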